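/- **Setting.** A social network is a directed graph on a finite user set $V$, $|V|\ge 2$, where an edge $(i,j)$ means that $j$ follows $i$; user $i$ posts to user $j$ at rate $\lambda_{ij}$, with $\lambda_{ij}>0$ on edges and $\lambda_{ij}=0$ otherwise. Let $f(x)=\omega x$ if $|x|\le\epsilon$ and $f(x)=0$ otherwise, with $\omega,\epsilon>0$. A *configuration* consists of such a network, the numbers $\omega,\epsilon$, an interval of opinions $[u_{\min},u_{\max}]$ with $u_{\min}<u_{\max}$, initial opinions $\theta_i(0)\in[u_{\min},u_{\max}]$, an integer final time $T\ge1$, an agent posting rate $\lambda_{\max}>0$, a regularization constant $\gamma>0$, an ordered list $C$ of distinct users (the candidate targets), and an objective $r$ to be maximized, which is one of: the mean $\mu=\frac1{|V|}\sum_i\theta_i$, the variance $\frac1{|V|-1}\sum_i(\theta_i-\mu)^2$, or the negative of the variance. **Greedy content policy.** Let $A$ be a finite set of agents and $x\in\{0,1\}^{A\times V}$ a target matrix. For $t=0,1,\dots,T-1$, each agent $a$ chooses $$u_a(t)\in\arg\max_{u}\ \sum_{i\in V}\frac{\partial r}{\partial\theta_i}(\theta(t))\,x_{ai}\,f(u-\theta_i(t))$$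 over $u\in[u_{\min},u_{\max}]$ and, if $t\ge1$, also $|u-u_a(t-1)|\le\gamma$. Then, for $s\in[t,t+1]$, the opinions solve, with $u_a(t)$ held fixed, $$\theta_i(s)=\theta_i(t)+\int_t^s\Big[\sum_{j\in V}\lambda_{ji}f(\theta_j(\tau)-\theta_i(\tau))+\lambda_{\max}\sum_{a\in A}x_{ai}f(u_a(t)-\theta_i(\tau))\Big]d\tau .$$ The outcome is $r(x):=r(\theta(T))$. **Greedy targeting policy** with at most $d$ targets per agent. Start with $x=0$, $S=\emptyset$, $r^*=0$. The agents are processed one after another. Agent $a$ goes in order through the candidates that are not in $S$ when its turn begins. For each such $i$ it sets $x_{ai}=1$ and computes $r(x)$ by the greedy content policy; if $r(x)>r^*$, then $i$ is added to $S$ and $r^*$ is replaced by $r(x)$, and otherwise $x_{ai}$ is reset to $0$. The agent stops when it has $d$ targets or the candidates are exhausted. For a configuration, let $r_k(d)$ be the final objective value of the greedy content policy with $k$ agents whose targets are found by the greedy targeting policy with at most $d$ targets per agent. Call $r_k(d)$ well defined if at least one execution of the two policies exists and all executions (over all choices of maximizers and of solutions of the integral equations) give the same value. **Proposition (limitations of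 adding agents under a suboptimal policy).** 1. (Fixed cap per agent.) There are a configuration, an integer $d\ge1$ and integers $0\le k<k'$ such that $r_k(d)$ and $r_{k'}(d)$ are well defined and $r_k(d)>r_{k'}(d)$. 2. (Fixed total budget.) There are a configuration and integers $1\le k<k'$ and $d,d'\ge1$ with $kd=k'd'$ such that $r_k(d)$ and $r_{k'}(d')$ are well defined and $r_k(d)>r_{k'}(d')$. -/

import Mathlib

open MeasureTheory

noncomputable section

namespace InfluenceCampaign

/-- The bounded confidence shift function with persuasion strength `ω` and confidence interval `ε`. -/
def shift (ω ε x : ℝ) : ℝ := if |x| ≤ ε then ω * x else 0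

/-- The mean of an opinion vector. -/
def mean {n : ℕ} (θ : Fin n → ℝ) : ℝ := (1 / (n : ℝ)) * ∑ i, θ i

/-- The (sample) variance of an opinion vector. -/
def variance {n : ℕ} (θ : Fin n → ℝ) : ℝ :=
  (1 / ((n : ℝ) - 1)) * ∑ i, (θ i - mean θ) ^ 2

/-- The three opinion objectives. -/
inductive Objective where
  | maxMean
  | minVariance
  | maxVariance

/-- The objective function `r`; it is always to be maximized. -/
def Objective.value {n : ℕ} : Objective → (Fin n → ℝ) → ℝ
  | .maxMean, θ => mean θ
  | .minVariance, θ => -variance θ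
  | .maxVariance, θ => variance θ

/-- The partial derivative `∂r/∂θ_i` at `θ`. -/
def Objective.partialDeriv {n : ℕ} (r : Objective) (θ : Fin n → ℝ) (i : Fin n) : ℝ :=
  deriv (fun s => r.value (Function.update θ i s)) (θ i)

/-- The data of an influence campaign on a social network with user set `Fin n`, apart from
the number of agents and the cap on the number of targets of each agent. -/
structure Config (n : ℕ) where
  two_le_card : 2 ≤ n
  /-- `graph.Adj i j` means that user `j` follows user `i`. -/
  graph : Digraph (Fin n)
  /-- `rate i j` is the rate at which user `i` shares content with user `j`. -/
  rate : Fin n → Fin n → ℝ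
  rate_pos : ∀ i j, graph.Adj i j → 0 < rate i j
  rate_eq_zero : ∀ i j, ¬ graph.Adj i j → rate i j = 0
  /-- Persuasion strength. -/
  omega : ℝ
  omega_pos : 0 < omega
  /-- Confidence interval. -/
  eps : ℝ
  eps_pos : 0 < eps
  /-- Most extreme opinions. -/
  umin : ℝ
  umax : ℝ
  umin_lt_umax : umin < umax
  /-- Initial opinions. -/
  init : Fin n → ℝ
  init_mem : ∀ i, init i ∈ Set.Icc umin umax
  /-- Final time; the agents update their opinions at the times `0, 1, …, horizon - 1`. -/
  horizon : ℕ
  horizon_pos : 0 < horizon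
  /-- Posting rate of every agent. -/
  agentRate : ℝ
  agentRate_pos : 0 < agentRate
  /-- Regularization constant: bound on the change of an agent's opinion in one update. -/
  gamma : ℝ
  gamma_pos : 0 < gamma
  /-- The opinion objective. -/
  objective : Objective
  /-- The consideration set of potential targets, in the order in which it is searched. -/
  candidates : List (Fin n)
  candidates_nodup : candidates.Nodup

variable {n : ℕ} (c : Config n) {k : ℕ}

/-- A target assignment for `k` agents: `x a` is the set of targets of agent `a`,
i.e. `x_{ai} = 1` if and only if `i ∈ x a`. -/
abbrev Assignment (n k : ℕ) : Type := Fin k → Finset (Fin n)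

/-- The right-hand side of the opinion dynamics of user `i`, for opinions `θ` of the users and
opinions `v` of the agents. -/
def velocity (x : Assignment n k) (v : Fin k → ℝ) (θ : Fin n → ℝ) (i : Fin n) : ℝ :=
  (∑ j, c.rate j i * shift c.omega c.eps (θ j - θ i)) +
    c.agentRate * ∑ a, (if i ∈ x a then 1 else 0) * shift c.omega c.eps (v a - θ i)

/-- What agent `a` greedily maximizes over its opinion `w` when the users have opinions `θ`. -/
def score (x : Assignment n k) (θ : Fin n → ℝ) (a : Fin k) (w : ℝ) : ℝ :=
  ∑ i, c.objective.partialDeriv θ i * (if i ∈ x a then 1 else 0) *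
    shift c.omega c.eps (w - θ i)

/-- The opinions available to agent `a` at the update time `t`, given its earlier opinions. -/
def feasible (u : ℕ → Fin k → ℝ) (a : Fin k) : ℕ → Set ℝ
  | 0 => Set.Icc c.umin c.umax
  | t + 1 => Set.Icc c.umin c.umax ∩ Set.Icc (u t a - c.gamma) (u t a + c.gamma)

/-- A run of the greedy content policy with targets `x`. Here `u t a` is the opinion of agent `a`
during `[t, t + 1]`, and `θ s i` is the opinion of user `i` at time `s`. At every update time every
agent takes an opinion with the largest score among the available ones; between update times the
opinions of the users solve the (discontinuous) opinion dynamics in integral form. -/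
def IsContentRun (x : Assignment n k) (u : ℕ → Fin k → ℝ) (θ : ℝ → Fin n → ℝ) : Prop :=
  θ 0 = c.init ∧
  ∀ t < c.horizon,
    (∀ a, u t a ∈ feasible c u a t ∧
      IsMaxOn (score c x (θ t) a) (feasible c u a t) (u t a)) ∧
    ∀ i, IntervalIntegrable (fun τ => velocity c x (u t) (θ τ) i) volume t (t + 1) ∧
      ∀ s ∈ Set.Icc (t : ℝ) (t + 1),
        θ s i = θ t i + ∫ τ in (t : ℝ)..s, velocity c x (u t) (θ τ) i

/-- `ρ` is the final objective value of some run of the greedy content policy with targets `x`. -/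
def IsContentValue (x : Assignment n k) (ρ : ℝ) : Prop :=
  ∃ u θ, IsContentRun c x u θ ∧ c.objective.value (θ c.horizon) = ρ

/-- The variables of the greedy targeting policy: the targets assigned so far, the set of users
selected so far, and the current best objective value. -/
structure TargetState (n k : ℕ) where
  targets : Assignment n k
  selected : Finset (Fin n)
  best : ℝ

/-- The initial values of these variables. -/
def TargetState.start (n k : ℕ) : TargetState n k where
  targets := fun _ => ∅
  selected := ∅
  best := 0

/-- The assignment `x` with `x_{ai}` set to `1`. -/
def addTarget (x : Assignment n k) (a : Fin k) (i : Fin n) : Assignment n k :=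
  Function.update x a (insert i (x a))

/-- The variables after user `i` has been accepted as a target of agent `a`, with objective
value `ρ`. -/
def TargetState.accept (σ : TargetState n k) (a : Fin k) (i : Fin n) (ρ : ℝ) :
    TargetState n k where
  targets := addTarget σ.targets a i
  selected := insert i σ.selected
  best := ρ

/-- The target iteration of agent `a` with at most `d` targets: `TargetLoop c d a l m σ σ'` means
that the iteration can lead from the state `σ` to the state `σ'` when the users in `l` remain to be
examined and `a` has `m` targets already. -/
inductive TargetLoop (d : ℕ) (a : Fin k) :
    List (Fin n) → ℕ → TargetState n k → TargetState n k → Prop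
  | done (m : ℕ) (σ : TargetState n k) : TargetLoop d a [] m σ σ
  | acceptBreak (i : Fin n) (l : List (Fin n)) (m : ℕ) (σ : TargetState n k) (ρ : ℝ)
      (hρ : IsContentValue c (addTarget σ.targets a i) ρ) (hbest : σ.best < ρ)
      (hd : d ≤ m + 1) :
      TargetLoop d a (i :: l) m σ (σ.accept a i ρ)
  | acceptContinue (i : Fin n) (l : List (Fin n)) (m : ℕ) (σ σ' : TargetState n k) (ρ : ℝ)
      (hρ : IsContentValue c (addTarget σ.targets a i) ρ) (hbest : σ.best < ρ)
      (hd : m + 1 < d) (next : TargetLoop d a l (m + 1) (σ.accept a i ρ) σ') :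
      TargetLoop d a (i :: l) m σ σ'
  | rejectBreak (i : Fin n) (l : List (Fin n)) (m : ℕ) (σ : TargetState n k) (ρ : ℝ)
      (hρ : IsContentValue c (addTarget σ.targets a i) ρ) (hbest : ρ ≤ σ.best)
      (hd : d ≤ m) :
      TargetLoop d a (i :: l) m σ σ
  | rejectContinue (i : Fin n) (l : List (Fin n)) (m : ℕ) (σ σ' : TargetState n k) (ρ : ℝ)
      (hρ : IsContentValue c (addTarget σ.targets a i) ρ) (hbest : ρ ≤ σ.best)
      (hd : m < d) (next : TargetLoop d a l m σ σ') :
      TargetLoop d a (i :: l) m σ σ'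

/-- The agent iteration: the agents in the list run their target iterations one after another, each
over the candidates that have not been selected before. -/
inductive AgentLoop (d : ℕ) :
    List (Fin k) → TargetState n k → TargetState n k → Prop
  | done (σ : TargetState n k) : AgentLoop d [] σ σ
  | step (a : Fin k) (l : List (Fin k)) (σ σ' σ'' : TargetState n k)
      (target : TargetLoop c d a (c.candidates.filter (fun i => i ∉ σ.selected)) 0 σ σ')
      (next : AgentLoop d l σ' σ'') :
      AgentLoop d (a :: l) σ σ''

/-- The objective values that `k` agents with at most `d` targets each can attain by the greedy
targeting policy followed by the greedy content policy. The policies leave open how ties in the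
maximization are broken; the value is well defined when this set is a singleton. -/
def greedyValues (k d : ℕ) : Set ℝ :=
  {ρ | ∃ σ : TargetState n k,
    AgentLoop c d (List.finRange k) (TargetState.start n k) σ ∧ IsContentValue c σ.targets ρ}

end InfluenceCampaign

end

noncomputable section

namespace InfluenceCampaign

open Set

/-! One network, `leaderConfig`, serves both parts: a leader at opinion 1, two followers at 0, hence
exactly at the confidence radius, and an isolated user at 0; the mean is maximized over one time
step. Left alone, the leader stays at 1 and pulls the followers up. An agent that targets only the
leader plays 3/2; the leader then runs away faster than the followers can move, they lose contact at
once, and the mean ends lower. The targeting policy accepts this harmful target because it compares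
with 0 and not with the value without agents.

Part 1 compares no agent with one agent of cap 1. In part 2 a single agent with both targets must
play 1 to keep the isolated user within reach, so the leader stays; two agents with one target each
separate the tasks, and the first draws the leader away. The isolated user gains the same in both
cases, so both parts rest on `leader_value_lt_no_agent_value`.

The dynamics are discontinuous, so uniqueness of solutions needs proof: `solves_relax_iff` treats
attraction to a fixed opinion, `solves_escape_iff` the lost followers. -/

/-! ### Scalar bounded confidence equations in integral form. -/

/-- `y` solves `y' = v` on `[0, 1]` in integral form. -/
def Solves (v y : ℝ → ℝ) : Prop :=
  IntervalIntegrable v volume 0 1 ∧ ∀ s ∈ Icc (0 : ℝ) 1, y s = y 0 + ∫ τ in (0 : ℝ)..s, v τ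

theorem Solves.congr {v v' y : ℝ → ℝ} (h : Solves v y) (hv : ∀ s ∈ Icc (0 : ℝ) 1, v s = v' s) :
    Solves v' y := by
  refine ⟨h.1.congr fun s hs => ?_, fun s hs => ?_⟩
  · rw [uIoc_of_le zero_le_one] at hs
    exact hv s ⟨hs.1.le, hs.2⟩
  · rw [h.2 s hs]
    congr 1
    refine intervalIntegral.integral_congr fun τ hτ => ?_
    rw [uIcc_of_le hs.1] at hτ
    exact hv τ ⟨hτ.1, hτ.2.trans hs.2⟩

theorem solves_congr {v v' y : ℝ → ℝ} (hv : ∀ s ∈ Icc (0 : ℝ) 1, v s = v' s) :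
    Solves v y ↔ Solves v' y :=
  ⟨fun h => h.congr hv, fun h => h.congr fun s hs => (hv s hs).symm⟩

theorem solves_of_hasDerivAt {v y z z' : ℝ → ℝ} (hz : ∀ s, HasDerivAt z (z' s) s)
    (hz' : Continuous z') (hy : ∀ s ∈ Icc (0 : ℝ) 1, y s = z s)
    (hv : ∀ s ∈ Icc (0 : ℝ) 1, v s = z' s) : Solves v y := by
  rw [solves_congr hv]
  refine ⟨hz'.intervalIntegrable _ _, fun s hs => ?_⟩
  rw [intervalIntegral.integral_eq_sub_of_hasDerivAt (fun τ _ => hz τ)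
    (hz'.intervalIntegrable _ _), hy s hs, hy 0 ⟨le_rfl, zero_le_one⟩]
  ring

theorem Solves.sub_eq {v y : ℝ → ℝ} (h : Solves v y) {s t : ℝ} (hs : s ∈ Icc (0 : ℝ) 1)
    (ht : t ∈ Icc (0 : ℝ) 1) : y t - y s = ∫ τ in s..t, v τ := by
  have hi : ∀ r ∈ Icc (0 : ℝ) 1, IntervalIntegrable v volume 0 r := fun r hr =>
    h.1.mono_set (by rw [uIcc_of_le hr.1, uIcc_of_le zero_le_one]; exact Icc_subset_Icc_right hr.2)
  rw [h.2 s hs, h.2 t ht, ← intervalIntegral.integral_interval_sub_left (hi t ht) (hi s hs)]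
  ring

theorem Solves.continuousOn {v y : ℝ → ℝ} (h : Solves v y) : ContinuousOn y (Icc 0 1) := by
  have := intervalIntegral.continuousOn_primitive_interval
    (μ := volume) (f := v) (a := 0) (b := 1)
    (by
        rw [uIcc_of_le zero_le_one]
        exact (intervalIntegrable_iff_integrableOn_Icc_of_le zero_le_one).1 h.1)
  rw [uIcc_of_le zero_le_one] at this
  exact (continuousOn_const.add this).congr h.2

theorem shift_of_abs_le {x : ℝ} (h : |x| ≤ 1) : shift 1 1 x = x := by
  simp [shift, h]

theorem shift_of_lt_abs {x : ℝ} (h : 1 < |x|) : shift 1 1 x = 0 := by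
  simp [shift, not_le.2 h]

theorem shift_le_one (x : ℝ) : shift 1 1 x ≤ 1 := by
  rcases le_or_gt |x| 1 with h | h
  · rw [shift_of_abs_le h]
    exact (abs_le.1 h).2
  · rw [shift_of_lt_abs h]
    exact zero_le_one

/-- A user that starts within the confidence interval of a constant opinion stays within it. -/
theorem Solves.abs_sub_le {κ w y₀ : ℝ} {y : ℝ → ℝ} (h₀ : y 0 = y₀) (hw : |w - y₀| ≤ 1)
    (h : Solves (fun τ => κ * shift 1 1 (w - y τ)) y) {s : ℝ} (hs : s ∈ Icc (0 : ℝ) 1) :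
    |w - y s| ≤ 1 := by
  by_contra! hlt
  have hsub : Icc 0 s ⊆ Icc (0 : ℝ) 1 := Icc_subset_Icc_right hs.2
  have hcont : ContinuousOn (fun τ => |w - y τ|) (Icc 0 s) :=
    ((continuousOn_const.sub h.continuousOn).abs).mono hsub
  set K := Icc 0 s ∩ (fun τ => |w - y τ|) ⁻¹' Iic 1
  have hK : IsCompact K := by
    refine isCompact_Icc.of_isClosed_subset ?_ inter_subset_left
    exact hcont.preimage_isClosed_of_isClosed isClosed_Icc isClosed_Iic
  -- Let `t` be the last time up to `s` within the interval. After `t` the force vanishes, so `y` is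
  -- constant on `[t, s]` and cannot have left.
  obtain ⟨t, ⟨ht, ht'⟩, hmax⟩ := hK.exists_isGreatest
    ⟨0, ⟨le_rfl, hs.1⟩, by simpa [h₀] using hw⟩
  have hst := h.sub_eq (hsub ht) hs
  have : ∫ τ in t..s, κ * shift 1 1 (w - y τ) = ∫ τ in t..s, (0 : ℝ) := by
    refine intervalIntegral.integral_congr_ae (ae_of_all _ fun τ hτ => ?_)
    rw [uIoc_of_le ht.2] at hτ
    rw [shift_of_lt_abs, mul_zero]
    by_contra! hle
    exact absurd (hmax ⟨⟨ht.1.trans hτ.1.le, hτ.2⟩, hle⟩) (not_le.2 hτ.1)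
  rw [this, intervalIntegral.integral_zero, sub_eq_zero] at hst
  rw [hst] at hlt
  exact absurd ht' (not_le.2 hlt)

theorem hasDerivAt_relax (κ w y₀ s : ℝ) :
    HasDerivAt (fun s => w - (w - y₀) * Real.exp (-(κ * s)))
      (κ * ((w - y₀) * Real.exp (-(κ * s)))) s := by
  have h : HasDerivAt (fun s => -(κ * s)) (-κ) s := by
    simpa only [neg_mul, mul_one, id] using (hasDerivAt_id s).const_mul (-κ)
  exact ((h.exp.const_mul (w - y₀)).const_sub w).congr_deriv (by ring)

/-- Relaxation towards a constant opinion within the confidence interval. -/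
theorem solves_relax_iff {κ w y₀ : ℝ} {y : ℝ → ℝ} (hκ : 0 ≤ κ) (h₀ : y 0 = y₀)
    (hw : |w - y₀| ≤ 1) :
    Solves (fun τ => κ * shift 1 1 (w - y τ)) y ↔
      ∀ s ∈ Icc (0 : ℝ) 1, y s = w - (w - y₀) * Real.exp (-(κ * s)) := by
  constructor
  · intro h
    have h' : Solves (fun τ => κ * (w - y τ)) y :=
      h.congr fun s hs => by rw [shift_of_abs_le (h.abs_sub_le h₀ hw hs)]
    have hdiff : ∀ s ∈ Ico (0 : ℝ) 1, HasDerivWithinAt y (κ * (w - y s)) (Ici s) s := by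
      intro s hs
      have hc : ContinuousOn (fun τ => κ * (w - y τ)) (Icc 0 1) :=
        continuousOn_const.mul (continuousOn_const.sub h.continuousOn)
      have hnhds : Icc (0 : ℝ) 1 ∈ nhdsWithin s (Ici s) :=
        Filter.mem_of_superset (Icc_mem_nhdsGE hs.2) (Icc_subset_Icc_left hs.1)
      have hs' : s ∈ Icc (0 : ℝ) 1 := ⟨hs.1, hs.2.le⟩
      have hcs : ContinuousWithinAt (fun τ => κ * (w - y τ)) (Ici s) s :=
        (hc s hs').mono_of_mem_nhdsWithin hnhds
      have hd := intervalIntegral.integral_hasDerivWithinAt_right (a := 0) (b := s)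
        (f := fun τ => κ * (w - y τ)) (s := Ici s) (t := Ioi s)
        (h'.1.mono_set (by
          rw [uIcc_of_le hs.1, uIcc_of_le zero_le_one]; exact Icc_subset_Icc_right hs.2.le))
        ⟨Icc 0 1, nhdsWithin_mono _ Ioi_subset_Ici_self hnhds,
          hc.aestronglyMeasurable measurableSet_Icc⟩
        (hcs.mono Ioi_subset_Ici_self)
      refine (hd.const_add (y 0)).congr_of_eventuallyEq ?_ (h'.2 s hs')
      filter_upwards [hnhds] with τ hτ using h'.2 τ hτ
    have hexp : ∀ s, HasDerivAt (fun s => Real.exp (κ * s)) (Real.exp (κ * s) * κ) s := fun s => by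
      simpa using (((hasDerivAt_id s).const_mul κ).exp)
    -- Since `y` never leaves the interval, the equation is linear, and the integrating factor `exp
    -- (κ * s)` gives a conserved quantity.
    have hconst := constant_of_has_deriv_right_zero (a := (0 : ℝ)) (b := 1)
      (f := fun s => (w - y s) * Real.exp (κ * s))
      ((continuousOn_const.sub h.continuousOn).mul (by fun_prop)) (fun s hs => by
        exact (((hdiff s hs).const_sub w).mul (hexp s).hasDerivWithinAt).congr_deriv (by ring))
    intro s hs
    have := hconst s hs
    simp only [h₀, mul_zero, Real.exp_zero, mul_one] at this
    rw [← this, mul_assoc, ← Real.exp_add]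
    simp
  · intro h
    refine solves_of_hasDerivAt (hasDerivAt_relax κ w y₀) (by fun_prop) h fun s hs => ?_
    rw [h s hs, sub_sub_cancel, shift_of_abs_le]
    rw [abs_mul, Real.abs_exp]
    refine mul_le_one₀ hw (Real.exp_nonneg _) (Real.exp_le_one_iff.2 ?_)
    have := mul_nonneg hκ hs.1
    linarith

/-- A leader that moves fast enough is lost by a follower at the critical distance. -/
theorem solves_escape_iff {x y : ℝ → ℝ} (h₀ : y 0 = 0)
    (hx : ∀ s ∈ Icc (0 : ℝ) 1, x s = 3 / 2 - (3 / 2 - 1) * Real.exp (-(1 * s))) :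
    Solves (fun τ => 1 / 4 * shift 1 1 (x τ - y τ)) y ↔ ∀ s ∈ Icc (0 : ℝ) 1, y s = 0 := by
  -- The follower's speed is at most 1/4, while the leader stays strictly above `1 + s / 4` for `s >
  -- 0`; their distance then exceeds 1.
  have key : ∀ s ∈ Ioc (0 : ℝ) 1, y s ≤ s / 4 → shift 1 1 (x s - y s) = 0 := by
    intro s hs hy
    refine shift_of_lt_abs (lt_abs.2 (Or.inl ?_))
    rw [hx s ⟨hs.1.le, hs.2⟩, one_mul, Real.exp_neg]
    have h1 := Real.add_one_lt_exp hs.1.ne'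
    have h2 : (Real.exp s)⁻¹ < 1 - s / 2 := by
      rw [inv_lt_iff_one_lt_mul₀ (Real.exp_pos s)]
      -- `(1 + s) * (1 - s / 2) = 1 + s * (1 - s) / 2 ≥ 1` on `[0, 1]`.
      nlinarith [hs.1, hs.2]
    linarith
  have zero : (∀ s ∈ Ioc (0 : ℝ) 1, y s ≤ s / 4) → ∀ s ∈ Icc (0 : ℝ) 1,
      ∫ τ in (0 : ℝ)..s, 1 / 4 * shift 1 1 (x τ - y τ) = 0 := by
    intro hy s hs
    refine Eq.trans ?_ (intervalIntegral.integral_zero (a := 0) (b := s) (μ := volume) (E := ℝ))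
    -- Only at time 0 is the leader within reach, and the half-open interval omits that point.
    refine intervalIntegral.integral_congr_ae (ae_of_all _ fun τ hτ => ?_)
    rw [uIoc_of_le hs.1] at hτ
    have hτ' : τ ∈ Ioc (0 : ℝ) 1 := ⟨hτ.1, hτ.2.trans hs.2⟩
    rw [key τ hτ' (hy τ hτ'), mul_zero]
  constructor
  · intro h s hs
    have hle : ∀ s ∈ Ioc (0 : ℝ) 1, y s ≤ s / 4 := by
      intro s hs
      have hi := intervalIntegral.integral_mono_on (g := fun _ => (1 / 4 : ℝ)) hs.1.le
        (h.1.mono_set (by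
          rw [uIcc_of_le hs.1.le, uIcc_of_le zero_le_one]; exact Icc_subset_Icc_right hs.2))
        (by simp) (fun τ _ => by linarith [shift_le_one (x τ - y τ)])
      rw [h.2 s ⟨hs.1.le, hs.2⟩, h₀]
      simp only [intervalIntegral.integral_const, smul_eq_mul] at hi
      linarith
    rw [h.2 s hs, h₀, zero hle s hs, add_zero]
  · intro h
    have hle : ∀ s ∈ Ioc (0 : ℝ) 1, y s ≤ s / 4 := fun s hs => by
      rw [h s ⟨hs.1.le, hs.2⟩]; linarith [hs.1]
    refine ⟨?_, fun s hs => by rw [zero hle s hs, h s hs, h₀, add_zero]⟩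
    refine (intervalIntegrable_const (c := (0 : ℝ))).congr fun s hs => ?_
    rw [uIoc_of_le zero_le_one] at hs
    simp [key s hs (hle s hs)]

theorem partialDeriv_maxMean {n : ℕ} (θ : Fin n → ℝ) (i : Fin n) :
    Objective.maxMean.partialDeriv θ i = 1 / n := by
  have : (fun s => Objective.maxMean.value (Function.update θ i s)) =
      fun s => (1 / (n : ℝ)) * (s + ∑ j ∈ Finset.univ \ {i}, θ j) := by
    funext s
    simp [Objective.value, mean, Finset.sum_update_of_mem]
  rw [Objective.partialDeriv, this]
  simp

/-! ### Targeting steps with a unique outcome. -/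

section Greedy

variable {n k d : ℕ} {c : Config n}

/-- When the trial assignment has a single possible value and it beats the current best, rejection
is impossible and the loop is deterministic. -/
theorem targetLoop_cons_iff_of_last {a : Fin k} {i : Fin n} {l : List (Fin n)} {m : ℕ}
    {σ σ' : TargetState n k} {v : ℝ}
    (hv : ∀ ρ, IsContentValue c (addTarget σ.targets a i) ρ ↔ ρ = v)
    (hbest : σ.best < v) (hd : d ≤ m + 1) :
    TargetLoop c d a (i :: l) m σ σ' ↔ σ' = σ.accept a i v := by
  constructor
  · intro h
    cases h with
    | acceptBreak _ _ _ _ ρ hρ _ _ => rw [(hv ρ).1 hρ]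
    | acceptContinue => omega
    | rejectBreak _ _ _ _ ρ hρ hb _ => exact absurd ((hv ρ).1 hρ ▸ hb) (not_le.2 hbest)
    | rejectContinue _ _ _ _ _ ρ hρ hb _ _ => exact absurd ((hv ρ).1 hρ ▸ hb) (not_le.2 hbest)
  · rintro rfl
    exact .acceptBreak _ _ _ _ _ ((hv v).2 rfl) hbest hd

theorem targetLoop_cons_iff_of_not_last {a : Fin k} {i : Fin n} {l : List (Fin n)} {m : ℕ}
    {σ σ' : TargetState n k} {v : ℝ}
    (hv : ∀ ρ, IsContentValue c (addTarget σ.targets a i) ρ ↔ ρ = v)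
    (hbest : σ.best < v) (hd : m + 1 < d) :
    TargetLoop c d a (i :: l) m σ σ' ↔ TargetLoop c d a l (m + 1) (σ.accept a i v) σ' := by
  constructor
  · intro h
    cases h with
    | acceptBreak => omega
    | acceptContinue _ _ _ _ _ ρ hρ _ _ next => rwa [(hv ρ).1 hρ] at next
    | rejectBreak _ _ _ _ ρ hρ hb _ => exact absurd ((hv ρ).1 hρ ▸ hb) (not_le.2 hbest)
    | rejectContinue _ _ _ _ _ ρ hρ hb _ _ => exact absurd ((hv ρ).1 hρ ▸ hb) (not_le.2 hbest)
  · exact .acceptContinue _ _ _ _ _ _ ((hv v).2 rfl) hbest hd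

theorem agentLoop_nil_iff {σ σ' : TargetState n k} : AgentLoop c d [] σ σ' ↔ σ' = σ := by
  constructor
  · rintro ⟨⟩
    rfl
  · rintro rfl
    exact .done _

theorem agentLoop_cons_iff {a : Fin k} {l : List (Fin k)} {σ σ'' : TargetState n k} :
    AgentLoop c d (a :: l) σ σ'' ↔
      ∃ σ', TargetLoop c d a (c.candidates.filter (fun i => i ∉ σ.selected)) 0 σ σ' ∧
        AgentLoop c d l σ' σ'' := by
  constructor
  · rintro ⟨⟩
    exact ⟨_, ‹_›, ‹_›⟩
  · rintro ⟨σ', h, h'⟩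
    exact .step _ _ _ _ _ h h'

end Greedy

/-! ### The network and the agents' greedy opinions. -/

/-- User `0` has the two followers `1` and `2` at the critical distance; user `3` is isolated. The
candidate targets are the leader and the isolated user. -/
def leaderConfig : Config 4 where
  two_le_card := by norm_num
  graph.Adj i j := i = 0 ∧ (j = 1 ∨ j = 2)
  rate i j := if i = 0 ∧ (j = 1 ∨ j = 2) then 1 / 4 else 0
  rate_pos i j h := by
    rw [if_pos h]
    norm_num
  rate_eq_zero i j h := if_neg h
  omega := 1
  omega_pos := one_pos
  eps := 1
  eps_pos := one_pos
  umin := 0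
  umax := 3 / 2
  umin_lt_umax := by norm_num
  init := ![1, 0, 0, 0]
  init_mem i := by fin_cases i <;> norm_num
  horizon := 1
  horizon_pos := one_pos
  agentRate := 1
  agentRate_pos := one_pos
  gamma := 1
  gamma_pos := one_pos
  objective := .maxMean
  candidates := [0, 3]
  candidates_nodup := by decide

/-- Agent `a` with targets `x a` greedily chooses `w` at time `0`. -/
def IsBest {k : ℕ} (x : Assignment 4 k) (a : Fin k) (w : ℝ) : Prop :=
  w ∈ Icc (0 : ℝ) (3 / 2) ∧
    IsMaxOn (score leaderConfig x leaderConfig.init a) (Icc 0 (3 / 2)) w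

theorem score_leaderConfig {k : ℕ} (x : Assignment 4 k) (a : Fin k) (h1 : 1 ∉ x a)
    (h2 : 2 ∉ x a) (w : ℝ) :
    score leaderConfig x leaderConfig.init a w =
      1 / 4 * ((if 0 ∈ x a then 1 else 0) * shift 1 1 (w - 1) +
        (if 3 ∈ x a then 1 else 0) * shift 1 1 w) := by
  simp only [score, leaderConfig, partialDeriv_maxMean, Fin.sum_univ_four, h1, h2]
  simp
  split_ifs <;> ring

/-- The score is identically zero, so every available opinion is a maximizer; the choice is not
unique, but an agent without targets exerts no force. -/
theorem isBest_empty {k : ℕ} {x : Assignment 4 k} {a : Fin k} (h : x a = ∅) : IsBest x a 0 := by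
  refine ⟨by norm_num, isMaxOn_iff.2 fun w _ => ?_⟩
  simp [score_leaderConfig, h]

theorem isBest_iff_of_forall_lt {k : ℕ} {x : Assignment 4 k} {a : Fin k} {v : ℝ}
    (hv : v ∈ Icc (0 : ℝ) (3 / 2))
    (hlt : ∀ w ∈ Icc (0 : ℝ) (3 / 2), w ≠ v → score leaderConfig x leaderConfig.init a w <
      score leaderConfig x leaderConfig.init a v) {w : ℝ} :
    IsBest x a w ↔ w = v := by
  constructor
  · rintro ⟨hw, hmax⟩
    by_contra hne
    exact absurd (isMaxOn_iff.1 hmax v hv) (not_le.2 (hlt w hw hne))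
  · rintro rfl
    refine ⟨hv, isMaxOn_iff.2 fun z hz => ?_⟩
    rcases eq_or_ne z w with rfl | hne
    · exact le_rfl
    · exact (hlt z hz hne).le

theorem shift_cases (x : ℝ) : |x| ≤ 1 ∧ shift 1 1 x = x ∨ 1 < |x| ∧ shift 1 1 x = 0 := by
  rcases le_or_gt |x| 1 with h | h
  · exact Or.inl ⟨h, shift_of_abs_le h⟩
  · exact Or.inr ⟨h, shift_of_lt_abs h⟩

theorem isBest_leader_iff {k : ℕ} {x : Assignment 4 k} {a : Fin k} (h : x a = {0}) {w : ℝ} :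
    IsBest x a w ↔ w = 3 / 2 := by
  refine isBest_iff_of_forall_lt (by norm_num) fun w hw hne => ?_
  have hw' := lt_of_le_of_ne hw.2 hne
  have : shift 1 1 ((3 / 2 : ℝ) - 1) = 1 / 2 := by
    rw [shift_of_abs_le] <;> norm_num [abs_le]
  simp only [score_leaderConfig x a (by simp [h]) (by simp [h]), h]
  rcases shift_cases (w - 1) with ⟨_, h'⟩ | ⟨_, h'⟩
  · simp [this, h']
    linarith
  · simp [this, h']

theorem shift_lt_one {w : ℝ} (h : w ≠ 1) : shift 1 1 w < 1 := by
  rcases shift_cases w with ⟨h1, h'⟩ | ⟨_, h'⟩ <;> rw [h']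
  · exact lt_of_le_of_ne (abs_le.1 h1).2 h
  · exact one_pos

theorem isBest_isolated_iff {k : ℕ} {x : Assignment 4 k} {a : Fin k} (h : x a = {3}) {w : ℝ} :
    IsBest x a w ↔ w = 1 := by
  refine isBest_iff_of_forall_lt (by norm_num) fun w hw hne => ?_
  have : shift 1 1 (1 : ℝ) = 1 := shift_of_abs_le (by simp)
  simp only [score_leaderConfig x a (by simp [h]) (by simp [h]), h]
  have := shift_lt_one hne
  simp [*]

/-- Below 1 the two pulls increase with `w`; above 1 the isolated user is out of reach and the pull
on the leader is at most 1/2, against a total of 1 at `w = 1`. -/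
theorem isBest_both_iff {k : ℕ} {x : Assignment 4 k} {a : Fin k} (h : x a = {0, 3}) {w : ℝ} :
    IsBest x a w ↔ w = 1 := by
  refine isBest_iff_of_forall_lt (by norm_num) fun w hw hne => ?_
  have h1 : shift 1 1 (1 : ℝ) = 1 := shift_of_abs_le (by simp)
  have h0 : shift 1 1 (0 : ℝ) = 0 := shift_of_abs_le (by simp)
  simp only [score_leaderConfig x a (by simp [h]) (by simp [h]), h]
  have hlt : shift 1 1 (w - 1) + shift 1 1 w < 1 := by
    rcases lt_or_gt_of_ne hne with hlt | hgt
    · have := shift_lt_one hne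
      rcases shift_cases (w - 1) with ⟨_, h'⟩ | ⟨_, h'⟩ <;> rw [h'] <;> linarith
    · rw [shift_of_lt_abs (x := w) (lt_abs.2 (Or.inl hgt))]
      rcases shift_cases (w - 1) with ⟨_, h'⟩ | ⟨_, h'⟩ <;> rw [h'] <;> linarith [hw.2]
  simpa [h1, h0] using hlt

/-! ### Outcome of a content run on this network. -/

theorem velocity_leaderConfig_zero {k : ℕ} (x : Assignment 4 k) (v : Fin k → ℝ) (θ : Fin 4 → ℝ) :
    velocity leaderConfig x v θ 0 =
      ∑ a, (if 0 ∈ x a then 1 else 0) * shift 1 1 (v a - θ 0) := by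
  simp [velocity, leaderConfig]

theorem velocity_leaderConfig_three {k : ℕ} (x : Assignment 4 k) (v : Fin k → ℝ)
    (θ : Fin 4 → ℝ) :
    velocity leaderConfig x v θ 3 =
      ∑ a, (if 3 ∈ x a then 1 else 0) * shift 1 1 (v a - θ 3) := by
  simp [velocity, leaderConfig]

theorem velocity_leaderConfig_follower {k : ℕ} (x : Assignment 4 k) (v : Fin k → ℝ)
    (θ : Fin 4 → ℝ) {i : Fin 4} (hi : i = 1 ∨ i = 2) (hx : ∀ a, i ∉ x a) :
    velocity leaderConfig x v θ i = 1 / 4 * shift 1 1 (θ 0 - θ i) := by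
  simp [velocity, leaderConfig, hx, hi]

/-- The horizon is 1, so agents choose only once, at time 0, and the bound `gamma` never enters. -/
theorem isContentRun_leaderConfig_iff {k : ℕ} {x : Assignment 4 k} {u : ℕ → Fin k → ℝ}
    {θ : ℝ → Fin 4 → ℝ} :
    IsContentRun leaderConfig x u θ ↔ θ 0 = ![1, 0, 0, 0] ∧ (∀ a, IsBest x a (u 0 a)) ∧
      ∀ i, Solves (fun τ => velocity leaderConfig x (u 0) (θ τ) i) (fun s => θ s i) := by
  have h1 : ∀ P : ℕ → Prop, (∀ t < leaderConfig.horizon, P t) ↔ P 0 := fun P =>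
    ⟨fun h => h 0 one_pos, fun h t ht => by
      obtain rfl : t = 0 := Nat.lt_one_iff.1 ht
      exact h⟩
  refine and_congr_right fun h0 => ?_
  rw [h1]
  change θ 0 = leaderConfig.init at h0
  simp only [Nat.cast_zero, zero_add, h0]
  simp only [IsBest, ← h0, Solves]
  rfl

/-- The outcome is determined once the forces exerted by the agents and the resulting opinion of
the followers are. -/
theorem isContentValue_leaderConfig_iff {k : ℕ} {x : Assignment 4 k} {κ w κ' : ℝ} {φ : ℝ → ℝ}
    (hκ : 0 ≤ κ) (hw : |w - 1| ≤ 1) (hκ' : 0 ≤ κ') (hφ0 : φ 0 = 0)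
    (hφ : ∀ z y : ℝ → ℝ, y 0 = 0 →
      (∀ s ∈ Icc (0 : ℝ) 1, z s = w - (w - 1) * Real.exp (-(κ * s))) →
      (Solves (fun τ => 1 / 4 * shift 1 1 (z τ - y τ)) y ↔ ∀ s ∈ Icc (0 : ℝ) 1, y s = φ s))
    (hx : ∀ a, 1 ∉ x a ∧ 2 ∉ x a) (hex : ∀ a, ∃ v, IsBest x a v)
    (hforce : ∀ v : Fin k → ℝ, (∀ a, IsBest x a (v a)) → ∀ y,
      ∑ a, (if 0 ∈ x a then 1 else 0) * shift 1 1 (v a - y) = κ * shift 1 1 (w - y) ∧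
      ∑ a, (if 3 ∈ x a then 1 else 0) * shift 1 1 (v a - y) = κ' * shift 1 1 (1 - y)) (ρ : ℝ) :
    IsContentValue leaderConfig x ρ ↔
      ρ = 1 / 4 * (w - (w - 1) * Real.exp (-κ) + 2 * φ 1 + (1 - Real.exp (-κ'))) := by
  have hrun : ∀ (u : ℕ → Fin k → ℝ) (θ : ℝ → Fin 4 → ℝ), IsContentRun leaderConfig x u θ ↔
      θ 0 = ![1, 0, 0, 0] ∧ (∀ a, IsBest x a (u 0 a)) ∧ ∀ s ∈ Icc (0 : ℝ) 1,
        θ s = ![w - (w - 1) * Real.exp (-(κ * s)), φ s, φ s, 1 - Real.exp (-(κ' * s))] := by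
    intro u θ
    rw [isContentRun_leaderConfig_iff]
    refine and_congr_right fun h0 => and_congr_right fun hb => ?_
    have e0 := solves_relax_iff (κ := κ) (w := w) (y₀ := 1) (y := fun s => θ s 0) hκ
      (by simp [h0]) hw
    have e3 := solves_relax_iff (κ := κ') (w := 1) (y₀ := 0) (y := fun s => θ s 3) hκ'
      (by simp [h0]) (by simp)
    have e1 := hφ (fun s => θ s 0) (fun s => θ s 1) (by simp [h0])
    have e2 := hφ (fun s => θ s 0) (fun s => θ s 2) (by simp [h0])
    simp only [sub_zero, one_mul] at e3
    simp only [Fin.forall_fin_succ, Fin.succ_zero_eq_one, Fin.succ_one_eq_two, IsEmpty.forall_iff,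
      and_true, show Fin.succ (2 : Fin 3) = 3 from rfl, velocity_leaderConfig_zero,
      velocity_leaderConfig_three, (hforce _ hb _).1, (hforce _ hb _).2,
      velocity_leaderConfig_follower x _ _ (Or.inl rfl) fun a => (hx a).1,
      velocity_leaderConfig_follower x _ _ (Or.inr rfl) fun a => (hx a).2]
    rw [e0, e3]
    constructor
    · rintro ⟨g0, g1, g2, g3⟩ s hs
      -- The follower equations contain the leader's opinion, so its trajectory must be known first.
      rw [e1 g0] at g1
      rw [e2 g0] at g2
      ext i
      fin_cases i
      exacts [g0 s hs, g1 s hs, g2 s hs, g3 s hs]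
    · intro h
      have g0 : ∀ s ∈ Icc (0 : ℝ) 1, θ s 0 = w - (w - 1) * Real.exp (-(κ * s)) :=
        fun s hs => by simp [h s hs]
      rw [e1 g0, e2 g0]
      exact ⟨g0, fun s hs => by simp [h s hs], fun s hs => by simp [h s hs],
        fun s hs => by simp [h s hs]⟩
  have hval : ∀ θ : ℝ → Fin 4 → ℝ, (∀ s ∈ Icc (0 : ℝ) 1,
      θ s = ![w - (w - 1) * Real.exp (-(κ * s)), φ s, φ s, 1 - Real.exp (-(κ' * s))]) →
      leaderConfig.objective.value (θ leaderConfig.horizon) =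
        1 / 4 * (w - (w - 1) * Real.exp (-κ) + 2 * φ 1 + (1 - Real.exp (-κ'))) := by
    intro θ h
    have := h 1 (by simp)
    simp only [leaderConfig, Objective.value, mean, Nat.cast_one, this, Fin.sum_univ_four]
    simp
    ring
  constructor
  · rintro ⟨u, θ, h, rfl⟩
    exact hval θ ((hrun u θ).1 h).2.2
  · rintro rfl
    choose v hv using hex
    refine ⟨fun _ => v, fun s =>
      ![w - (w - 1) * Real.exp (-(κ * s)), φ s, φ s, 1 - Real.exp (-(κ' * s))],
      (hrun _ _).2 ⟨?_, hv, fun _ _ => rfl⟩, hval _ fun _ _ => rfl⟩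
    simp [hφ0]

/-- The outcome when the leader does not move. -/
theorem isContentValue_iff_of_leader_fixed {k : ℕ} {x : Assignment 4 k} {κ κ' : ℝ}
    (hκ : 0 ≤ κ) (hκ' : 0 ≤ κ') (hx : ∀ a, 1 ∉ x a ∧ 2 ∉ x a) (hex : ∀ a, ∃ v, IsBest x a v)
    (hforce : ∀ v : Fin k → ℝ, (∀ a, IsBest x a (v a)) → ∀ y,
      ∑ a, (if 0 ∈ x a then 1 else 0) * shift 1 1 (v a - y) = κ * shift 1 1 (1 - y) ∧
      ∑ a, (if 3 ∈ x a then 1 else 0) * shift 1 1 (v a - y) = κ' * shift 1 1 (1 - y)) (ρ : ℝ) :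
    IsContentValue leaderConfig x ρ ↔
      ρ = 1 / 4 * (1 + 2 * (1 - Real.exp (-(1 / 4))) + (1 - Real.exp (-κ'))) := by
  rw [isContentValue_leaderConfig_iff (φ := fun s => 1 - Real.exp (-(1 / 4 * s))) hκ
    (by simp) hκ' (by simp) ?_ hx hex hforce]
  · simp
  · intro z y hy hz
    -- With target opinion 1 the leader is already at equilibrium, whatever the strength `κ`; this
    -- covers both no agent and an agent playing 1.
    simp only [sub_self, zero_mul, sub_zero] at hz
    rw [solves_congr (v' := fun τ => 1 / 4 * shift 1 1 (1 - y τ)) fun s hs => by rw [hz s hs],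
      solves_relax_iff (by norm_num) hy (by simp)]
    simp

/-- The outcome when the leader is drawn away from the followers. -/
theorem isContentValue_iff_of_leader_moves {k : ℕ} {x : Assignment 4 k} {κ' : ℝ}
    (hκ' : 0 ≤ κ') (hx : ∀ a, 1 ∉ x a ∧ 2 ∉ x a) (hex : ∀ a, ∃ v, IsBest x a v)
    (hforce : ∀ v : Fin k → ℝ, (∀ a, IsBest x a (v a)) → ∀ y,
      ∑ a, (if 0 ∈ x a then 1 else 0) * shift 1 1 (v a - y) = 1 * shift 1 1 (3 / 2 - y) ∧
      ∑ a, (if 3 ∈ x a then 1 else 0) * shift 1 1 (v a - y) = κ' * shift 1 1 (1 - y)) (ρ : ℝ) :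
    IsContentValue leaderConfig x ρ ↔
      ρ = 1 / 4 * (1 + (1 - Real.exp (-1)) / 2 + (1 - Real.exp (-κ'))) := by
  rw [isContentValue_leaderConfig_iff (φ := fun _ => 0) zero_le_one
    (by norm_num [abs_le]) hκ' rfl (fun z y hy hz => solves_escape_iff hy hz) hx hex hforce]
  ring_nf

/-! ### Values of the target assignments that occur. -/

theorem isContentValue_no_agent (x : Assignment 4 0) (ρ : ℝ) :
    IsContentValue leaderConfig x ρ ↔
      ρ = 1 / 4 * (1 + 2 * (1 - Real.exp (-(1 / 4)))) := by
  rw [isContentValue_iff_of_leader_fixed (κ := 0) (κ' := 0) le_rfl le_rfl (fun a => a.elim0)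
    (fun a => a.elim0) (by simp)]
  simp

/-- Stated for any number of agents, since it evaluates the first trial both with one agent and with
two, where the other agent still has no targets. -/
theorem isContentValue_leader {k : ℕ} {x : Assignment 4 k} {a : Fin k}
    (hx : x = Function.update (fun _ => ∅) a {0}) (ρ : ℝ) :
    IsContentValue leaderConfig x ρ ↔ ρ = 1 / 4 * (1 + (1 - Real.exp (-1)) / 2) := by
  have ha : x a = {0} := by simp [hx]
  have hb : ∀ b, b ≠ a → x b = ∅ := fun b hb => by simp [hx, hb]
  rw [isContentValue_iff_of_leader_moves (κ' := 0) le_rfl]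
  · simp
  · intro b
    rcases eq_or_ne b a with rfl | h
    · simp [ha]
    · simp [hb b h]
  · intro b
    rcases eq_or_ne b a with rfl | h
    · exact ⟨_, (isBest_leader_iff ha).2 rfl⟩
    · exact ⟨_, isBest_empty (hb b h)⟩
  · intro v hv y
    have hva := (isBest_leader_iff ha).1 (hv a)
    constructor
    · rw [Finset.sum_eq_single a (fun b _ h => by simp [hb b h]) (by simp)]
      simp [ha, hva]
    · rw [zero_mul]
      refine Finset.sum_eq_zero fun b _ => ?_
      rcases eq_or_ne b a with rfl | h
      · simp [ha]
      · simp [hb b h]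

theorem isContentValue_joint {x : Assignment 4 1} (hx : x 0 = {0, 3}) (ρ : ℝ) :
    IsContentValue leaderConfig x ρ ↔
      ρ = 1 / 4 * (1 + 2 * (1 - Real.exp (-(1 / 4))) + (1 - Real.exp (-1))) := by
  refine isContentValue_iff_of_leader_fixed (κ := 1) zero_le_one zero_le_one ?_ ?_ ?_ ρ
  · simp [Fin.forall_fin_one, hx]
  · exact Fin.forall_fin_one.2 ⟨_, (isBest_both_iff hx).2 rfl⟩
  · intro v hv y
    simp [hx, (isBest_both_iff hx).1 (hv 0)]

theorem isContentValue_separate {x : Assignment 4 2} (hx : x 0 = {0}) (hx' : x 1 = {3}) (ρ : ℝ) :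
    IsContentValue leaderConfig x ρ ↔
      ρ = 1 / 4 * (1 + (1 - Real.exp (-1)) / 2 + (1 - Real.exp (-1))) := by
  refine isContentValue_iff_of_leader_moves zero_le_one ?_ ?_ ?_ ρ
  · simp [Fin.forall_fin_two, hx, hx']
  · exact Fin.forall_fin_two.2
      ⟨⟨_, (isBest_leader_iff hx).2 rfl⟩, ⟨_, (isBest_isolated_iff hx').2 rfl⟩⟩
  · intro v hv y
    simp [Fin.sum_univ_two, hx, hx', (isBest_leader_iff hx).1 (hv 0),
      (isBest_isolated_iff hx').1 (hv 1)]

/-! ### Executions of the targeting policy and comparison of their values. -/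

theorem addTarget_start {k : ℕ} (a : Fin k) :
    addTarget (TargetState.start 4 k).targets a 0 = Function.update (fun _ => ∅) a {0} := by
  simp [addTarget, TargetState.start]

theorem leader_value_pos : 0 < 1 / 4 * (1 + (1 - Real.exp (-1)) / 2) := by
  have : Real.exp (-1) < 1 := Real.exp_lt_one_iff.2 (by norm_num)
  linarith

theorem leader_value_lt_no_agent_value :
    1 / 4 * (1 + (1 - Real.exp (-1)) / 2) < 1 / 4 * (1 + 2 * (1 - Real.exp (-(1 / 4)))) := by
  set y := Real.exp (-(1 / 4)) with hy
  have h4 : Real.exp (-1) = y ^ 4 := by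
    rw [hy, ← Real.exp_nat_mul]
    norm_num
  have h0 : 0 < y := Real.exp_pos _
  have h1 : y < 1 := Real.exp_lt_one_iff.2 (by norm_num)
  -- The product equals `4 * (1 - y) - (1 - y ^ 4)`, a positive multiple of the gap between the two
  -- values.
  have h2 : 0 < (1 - y) * ((1 - y) + (1 - y ^ 2) + (1 - y ^ 3)) :=
    mul_pos (by linarith) (by
      linarith [pow_lt_one₀ h0.le h1 two_ne_zero, pow_lt_one₀ h0.le h1 three_ne_zero])
  rw [h4]
  nlinarith

theorem greedyValues_no_agent (d : ℕ) :
    greedyValues leaderConfig 0 d = {1 / 4 * (1 + 2 * (1 - Real.exp (-(1 / 4))))} := by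
  ext ρ
  simp [greedyValues, List.finRange_zero, agentLoop_nil_iff, isContentValue_no_agent]

theorem greedyValues_one_one :
    greedyValues leaderConfig 1 1 = {1 / 4 * (1 + (1 - Real.exp (-1)) / 2)} := by
  ext ρ
  have hc : leaderConfig.candidates.filter (fun i => i ∉ (TargetState.start 4 1).selected) =
      [0, 3] := by simp [leaderConfig, TargetState.start]
  simp only [greedyValues, show List.finRange 1 = [0] from rfl, mem_ofPred_eq,
    mem_singleton_iff, agentLoop_cons_iff, agentLoop_nil_iff, hc,
    targetLoop_cons_iff_of_last (isContentValue_leader (addTarget_start 0)) leader_value_pos le_rfl,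
    exists_eq_left, TargetState.accept, isContentValue_leader (addTarget_start 0)]

theorem greedyValues_one_two :
    greedyValues leaderConfig 1 2 =
      {1 / 4 * (1 + 2 * (1 - Real.exp (-(1 / 4))) + (1 - Real.exp (-1)))} := by
  ext ρ
  have hc : leaderConfig.candidates.filter (fun i => i ∉ (TargetState.start 4 1).selected) =
      [0, 3] := by simp [leaderConfig, TargetState.start]
  have hlt : 1 / 4 * (1 + (1 - Real.exp (-1)) / 2) <
      1 / 4 * (1 + 2 * (1 - Real.exp (-(1 / 4))) + (1 - Real.exp (-1))) := by
    have : Real.exp (-1) < 1 := Real.exp_lt_one_iff.2 (by norm_num)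
    linarith [leader_value_lt_no_agent_value]
  have hx : addTarget (addTarget (TargetState.start 4 1).targets 0 0) 0 3 0 = {0, 3} := by
    rw [addTarget_start]
    simp [addTarget, Finset.pair_comm]
  have hv : ∀ ρ, IsContentValue leaderConfig (addTarget ((TargetState.start 4 1).accept 0 0
      (1 / 4 * (1 + (1 - Real.exp (-1)) / 2))).targets 0 3) ρ ↔ _ := isContentValue_joint hx
  simp only [greedyValues, show List.finRange 1 = [0] from rfl, mem_ofPred_eq,
    mem_singleton_iff, agentLoop_cons_iff, agentLoop_nil_iff, hc,
    targetLoop_cons_iff_of_not_last (isContentValue_leader (addTarget_start 0)) leader_value_pos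
      one_lt_two, targetLoop_cons_iff_of_last (d := 2) (m := 0 + 1) hv hlt le_rfl, exists_eq_left]
  exact hv ρ

theorem greedyValues_two_one :
    greedyValues leaderConfig 2 1 =
      {1 / 4 * (1 + (1 - Real.exp (-1)) / 2 + (1 - Real.exp (-1)))} := by
  ext ρ
  have hc : leaderConfig.candidates.filter (fun i => i ∉ (TargetState.start 4 2).selected) =
      [0, 3] := by simp [leaderConfig, TargetState.start]
  have hc' : leaderConfig.candidates.filter
      (fun i => i ∉ ((TargetState.start 4 2).accept 0 0
        (1 / 4 * (1 + (1 - Real.exp (-1)) / 2))).selected) = [3] := by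
    simp [leaderConfig, TargetState.start, TargetState.accept]
  have hlt : 1 / 4 * (1 + (1 - Real.exp (-1)) / 2) <
      1 / 4 * (1 + (1 - Real.exp (-1)) / 2 + (1 - Real.exp (-1))) := by
    have : Real.exp (-1) < 1 := Real.exp_lt_one_iff.2 (by norm_num)
    linarith
  have hx : addTarget (addTarget (TargetState.start 4 2).targets 0 0) 1 3 0 = {0} := by
    rw [addTarget_start]
    simp [addTarget]
  have hx' : addTarget (addTarget (TargetState.start 4 2).targets 0 0) 1 3 1 = {3} := by
    rw [addTarget_start]
    simp [addTarget]
  have hv : ∀ ρ, IsContentValue leaderConfig (addTarget ((TargetState.start 4 2).accept 0 0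
      (1 / 4 * (1 + (1 - Real.exp (-1)) / 2))).targets 1 3) ρ ↔ _ := isContentValue_separate hx hx'
  simp only [greedyValues, show List.finRange 2 = [0, 1] from rfl, mem_ofPred_eq,
    mem_singleton_iff, agentLoop_cons_iff, agentLoop_nil_iff, hc,
    targetLoop_cons_iff_of_last (isContentValue_leader (addTarget_start 0)) leader_value_pos
      le_rfl, exists_eq_left, hc', targetLoop_cons_iff_of_last hv hlt le_rfl]
  exact hv ρ

end InfluenceCampaign

end

/-- Part 1: the campaign data and the cap `d` on the number of targets per agent are the same for
`k` and `k'` agents. Part 2: the campaign data and the total budget of targets, split evenly among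
the agents, are the same, and there is at least one agent. -/
theorem proposition1 :
    (∃ (n : ℕ) (c : InfluenceCampaign.Config n) (d k k' : ℕ) (r r' : ℝ),
      0 < d ∧ k < k' ∧
      InfluenceCampaign.greedyValues c k d = {r} ∧
      InfluenceCampaign.greedyValues c k' d = {r'} ∧
      r > r') ∧
    (∃ (n : ℕ) (c : InfluenceCampaign.Config n) (d d' k k' : ℕ) (r r' : ℝ),
      0 < d' ∧ 0 < k ∧ k < k' ∧ k * d = k' * d' ∧
      InfluenceCampaign.greedyValues c k d = {r} ∧
      InfluenceCampaign.greedyValues c k' d' = {r'} ∧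
      r > r') := by
  refine ⟨⟨4, InfluenceCampaign.leaderConfig, 1, 0, 1, _, _, one_pos, one_pos,
    InfluenceCampaign.greedyValues_no_agent 1, InfluenceCampaign.greedyValues_one_one,
    InfluenceCampaign.leader_value_lt_no_agent_value⟩,
    ⟨4, InfluenceCampaign.leaderConfig, 2, 1, 1, 2, _, _, one_pos, one_pos, one_lt_two, rfl,
    InfluenceCampaign.greedyValues_one_two, InfluenceCampaign.greedyValues_two_one, ?_⟩⟩
  -- Both values contain the isolated user's gain `1 - exp (-1)`, which cancels.
  linarith [InfluenceCampaign.leader_value_lt_no_agent_value]
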